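/- Let $\mathbb{K}$ be an algebraically closed field and $\Lambda$ a finite-dimensional $\mathbb{K}$-algebra. Let $\mathrm{proj}\,\Lambda$ be the category of finitely generated projective right $\Lambda$-modules and $K^b(\mathrm{proj}\,\Lambda)$ its bounded homotopy category. Every nonzero $X \in K^b(\mathrm{proj}\,\Lambda)$ is represented by a bounded complex $\bar X$, unique up to isomorphism of complexes, having no nonzero contractible direct summand. If $\bar X^r \neq 0 \neq \bar X^s$ and $\bar X^i = 0$ for $i<r$ and for $i>s$, put $\ell(X) = s-r$. The strong global dimension of $\Lambda$ is $$\mathrm{s.gl.dim}(\Lambda) = \sup\{\ell(X) \mid X \in K^b(\mathrm{proj}\,\Lambda) \text{ indecomposable}\}.$$ For $n \geq 2$ let $C_n(\mathrm{proj}\,\Lambda)$ be the category of complexes $X$ over $\mathrm{proj}\,\Lambda$ with $X^j = 0$ for $j \notin \{1,\dots,n\}$. A morphism $f$ of a category is irreducible if it is neither a section nor a retraction and, for every factorization $f = hg$ in that category, $h$ is a retraction or $g$ is a section. Proposition 2.4. Suppose that $\eta = \mathrm{s.gl.dim}(\Lambda)$ is finite (equivalently, $\Lambda$ is piecewise hereditary)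 and that $\eta \geq 1$. Let $f : X \to Y$ be an irreducible morphism in $C_{\eta+2}(\mathrm{proj}\,\Lambda)$ between indecomposable complexes $X$ and $Y$. Then $X^1 = 0 = Y^1$ or $X^{\eta+2} = 0 = Y^{\eta+2}$. -/

import Mathlib

open CategoryTheory CategoryTheory.Limits

universe u w

namespace FixedSizeComplexes

/-! ### Generalities on categories -/

/-- A full subcategory of a preadditive category has binary biproducts as soon as any two of its
objects have a biproduct whose underlying object lies in the subcategory. -/
theorem hasBinaryBiproducts_fullSubcategory {C : Type*} [Category C] [Preadditive C]
    (P : ObjectProperty C)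
    (h : ∀ X Y : C, P X → P Y → ∃ b : BinaryBicone X Y,
      P b.pt ∧ b.fst ≫ b.inl + b.snd ≫ b.inr = 𝟙 b.pt) :
    HasBinaryBiproducts P.FullSubcategory where
  has_binary_biproduct X Y := by
    obtain ⟨b, hb, hb'⟩ := h X.obj Y.obj X.property Y.property
    let b' : BinaryBicone X Y :=
      { pt := ⟨b.pt, hb⟩
        fst := ObjectProperty.homMk b.fst
        snd := ObjectProperty.homMk b.snd
        inl := ObjectProperty.homMk b.inl
        inr := ObjectProperty.homMk b.inr
        inl_fst := by ext; simp
        inl_snd := by ext; simp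
        inr_fst := by ext; simp
        inr_snd := by ext; simp }
    refine hasBinaryBiproduct_of_total b' ?_
    ext
    exact hb'

/-- A morphism `f` is irreducible if it is neither a section (split monomorphism) nor a retraction
(split epimorphism) and, whenever `f = h ∘ g`, the morphism `g` is a section or `h` is a
retraction. -/
def IsIrreducibleMorphism {C : Type*} [Category C] {X Y : C} (f : X ⟶ Y) : Prop :=
  ¬ IsSplitMono f ∧ ¬ IsSplitEpi f ∧
    ∀ ⦃W : C⦄ (g : X ⟶ W) (h : W ⟶ Y), g ≫ h = f → IsSplitMono g ∨ IsSplitEpi h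

section Algebra

variable (Λ : Type w) [Ring Λ]

/-! ### Finitely generated projective right modules and complexes of them -/

/-- The property of being a finitely generated projective right `Λ`-module; right `Λ`-modules are
modules over the opposite ring. -/
def isProjFG : ObjectProperty (ModuleCat.{w} Λᵐᵒᵖ) :=
  fun M => Module.Finite Λᵐᵒᵖ M ∧ Module.Projective Λᵐᵒᵖ M

/-- The category `proj Λ` of finitely generated projective right `Λ`-modules. -/
abbrev ProjMod : Type (w + 1) := (isProjFG Λ).FullSubcategory

instance : HasBinaryBiproducts (ProjMod Λ) :=
  hasBinaryBiproducts_fullSubcategory _ fun X Y hX hY => by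
    refine ⟨BinaryBiproduct.bicone X Y, ?_, biprod.total⟩
    obtain ⟨_, _⟩ := hX
    obtain ⟨_, _⟩ := hY
    let e : (X × Y) ≃ₗ[Λᵐᵒᵖ] (X ⊞ Y : ModuleCat.{w} Λᵐᵒᵖ) :=
      (ModuleCat.biprodIsoProd X Y).symm.toLinearEquiv
    exact ⟨Module.Finite.equiv e, Module.Projective.of_equiv e⟩

instance : HasZeroObject (ProjMod Λ) := by
  have : Module.Projective Λᵐᵒᵖ (ModuleCat.of Λᵐᵒᵖ PUnit.{w + 1}) :=
    inferInstanceAs (Module.Projective Λᵐᵒᵖ PUnit.{w + 1})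
  have : Module.Finite Λᵐᵒᵖ (ModuleCat.of Λᵐᵒᵖ PUnit.{w + 1}) :=
    inferInstanceAs (Module.Finite Λᵐᵒᵖ PUnit.{w + 1})
  refine ⟨⟨⟨ModuleCat.of Λᵐᵒᵖ PUnit.{w + 1}, ‹_›, ‹_›⟩, ?_⟩⟩
  rw [IsZero.iff_id_eq_zero]
  ext x

/-- The category `C(proj Λ)` of cochain complexes over `proj Λ`. -/
abbrev ProjComplex : Type (w + 1) := CochainComplex (ProjMod Λ) ℤ

/-- The complexes whose cells vanish outside the degrees `1, …, n`. -/
def isFixedSize (n : ℕ) : ObjectProperty (ProjComplex Λ) :=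
  fun X => ∀ i : ℤ, i < 1 ∨ (n : ℤ) < i → IsZero (X.X i)

/-- The category `Cₙ(proj Λ)` of complexes of fixed size `n`. -/
abbrev FixedSizeComplex (n : ℕ) : Type (w + 1) := (isFixedSize Λ n).FullSubcategory

/-- The bounded complexes. -/
def isBounded : ObjectProperty (ProjComplex Λ) :=
  fun X => ∃ a b : ℤ, ∀ i : ℤ, i < a ∨ b < i → IsZero (X.X i)

variable {Λ} in
theorem isZero_biprod_X (X Y : ProjComplex Λ) (i : ℤ) (hX : IsZero (X.X i))
    (hY : IsZero (Y.X i)) : IsZero ((X ⊞ Y).X i) :=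
  IsZero.of_iso ((biprod_isZero_iff _ _).2 ⟨hX, hY⟩)
    ((HomologicalComplex.eval (ProjMod Λ) (ComplexShape.up ℤ) i).mapBiprod X Y)

instance (n : ℕ) : HasBinaryBiproducts (FixedSizeComplex Λ n) :=
  hasBinaryBiproducts_fullSubcategory _ fun X Y hX hY =>
    ⟨BinaryBiproduct.bicone X Y,
      fun i hi => isZero_biprod_X X Y i (hX i hi) (hY i hi), biprod.total⟩

/-! ### The bounded homotopy category and the strong global dimension -/

/-- The bounded homotopy category `K^b(proj Λ)`: its objects are the bounded complexes, its
morphisms are the homotopy classes of morphisms of complexes. -/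
abbrev BoundedHomotopyCategory : Type (w + 1) :=
  ((isBounded Λ).strictMap
    (HomotopyCategory.quotient (ProjMod Λ) (ComplexShape.up ℤ))).FullSubcategory

instance : HasBinaryBiproducts (BoundedHomotopyCategory Λ) :=
  hasBinaryBiproducts_fullSubcategory _ fun X Y hX hY => by
    obtain ⟨K, a, b, hK⟩ := hX
    obtain ⟨L, c, d, hL⟩ := hY
    let F := HomotopyCategory.quotient (ProjMod Λ) (ComplexShape.up ℤ)
    refine ⟨F.mapBinaryBicone (BinaryBiproduct.bicone K L), ?_, ?_⟩
    · refine ObjectProperty.strictMap_obj _ _ ⟨min a c, max b d, fun i hi => ?_⟩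
      exact isZero_biprod_X K L i (hK i (by grind)) (hL i (by grind))
    · have h := congrArg F.map (biprod.total (X := K) (Y := L))
      rw [F.map_add, F.map_comp, F.map_comp, F.map_id] at h
      exact h

variable {Λ}

/-- A complex is contractible if its identity is homotopic to zero. The bounded contractible
complexes are the projective objects of `C^b(proj Λ)` for the degreewise split exact sequences. -/
def IsContractible (X : ProjComplex Λ) : Prop := Nonempty (Homotopy (𝟙 X) 0)

/-- A complex is minimal if it has no nonzero contractible (that is, projective) direct summand. -/
def IsMinimal (X : ProjComplex Λ) : Prop :=
  ∀ Z W : ProjComplex Λ, Nonempty (X ≅ Z ⊞ W) → IsContractible Z → IsZero Z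

/-- `ℓ(X) = m` for an object `X ≠ 0` of `K^b(proj Λ)`: there is a minimal complex `X'` isomorphic
to `X` in the homotopy category, with lowest nonzero cell in degree `r` and highest nonzero cell in
degree `s = r + m`. The complex `X'` is unique up to isomorphism of complexes. -/
def HasLength (X : BoundedHomotopyCategory Λ) (m : ℕ) : Prop :=
  ∃ X' : ProjComplex Λ, IsMinimal X' ∧
    Nonempty (X.obj ≅ (HomotopyCategory.quotient (ProjMod Λ) (ComplexShape.up ℤ)).obj X') ∧
    ∃ r s : ℤ, s = r + m ∧ ¬ IsZero (X'.X r) ∧ ¬ IsZero (X'.X s) ∧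
      ∀ i : ℤ, i < r ∨ s < i → IsZero (X'.X i)

variable (Λ)

/-- The strong global dimension of `Λ`: the supremum (possibly infinite) of the lengths of the
indecomposable objects of `K^b(proj Λ)`. -/
noncomputable def strongGlobalDimension : ℕ∞ :=
  sSup {m : ℕ∞ | ∃ (X : BoundedHomotopyCategory Λ) (k : ℕ),
    Indecomposable X ∧ HasLength X k ∧ m = k}

end Algebra

end FixedSizeComplexes

/-! Write n = η + 2. A bounded complex with only trivial idempotents is either contractible, hence
confined to two adjacent degrees, or a minimal representative of an indecomposable object of K^b,
hence of length at most η (`isZero_of_contractible`, `indecomposable_quotient`). So neither X nor Y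
meets both degree 1 and degree n (`isZero_of_strongGlobalDimension_le`), and two configurations
remain to be excluded.

If X¹ = 0 = Yⁿ while Y¹ and Xⁿ are nonzero, f factors through the truncation of Y to degrees at
least 2. This truncation is zero in degrees 1 and n, so neither factor splits
(`IsIrreducibleMorphism.false_of_isZero`).

If Xⁿ = 0 = Y¹ while X¹ and Yⁿ are nonzero, the homotopy class of f gives the contradiction. A
null-homotopic f would factor through a contractible complex in degrees 2, …, n - 1, and again
neither factor could split (`IsIrreducibleMorphism.not_isNullHomotopic`). On the other hand, the
cone of f lives in degrees 0, …, n, so by induction on length it is A ⊕ B with A⁰ = 0 = Bⁿ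
(`exists_decomposition`). The cocone W of A → X[1] then has size n, and f factors as X → W → Y.
Whichever factor splits, Fitting's lemma, for Y or for X, shows that f is null-homotopic or that A,
respectively B, is contractible. But A carries the cell Yⁿ and B the cell X¹, so contractibility
makes Y, respectively X, a two-term complex with invertible differential, and then f = 0
(`IsIrreducibleMorphism.isNullHomotopic`). -/

namespace FixedSizeComplexes

/-! ### Idempotents -/

section Idempotents

variable {C : Type*} [Category C]

/-- An object whose only idempotent endomorphisms are zero and the identity. -/
def HasTrivialIdempotents [Preadditive C] (X : C) : Prop :=
  ∀ e : X ⟶ X, e ≫ e = e → e = 0 ∨ e = 𝟙 X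

theorem isIdempotentComplete_fullSubcategory [IsIdempotentComplete C] (P : ObjectProperty C)
    (h : ∀ {X Y : C} (i : X ⟶ Y) (r : Y ⟶ X), i ≫ r = 𝟙 X → P Y → P X) :
    IsIdempotentComplete P.FullSubcategory where
  idempotents_split X p hp := by
    obtain ⟨Y, i, e, hi, he⟩ := IsIdempotentComplete.idempotents_split X.obj p.hom
      (by rw [← ObjectProperty.FullSubcategory.comp_hom, hp])
    refine ⟨⟨Y, h i e hi X.property⟩, ObjectProperty.homMk i, ObjectProperty.homMk e, ?_, ?_⟩
    · ext; exact hi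
    · ext; exact he

variable [Preadditive C]

theorem exists_splitting_of_idempotent [IsIdempotentComplete C] {X : C} (e : X ⟶ X)
    (he : e ≫ e = e) :
    ∃ (Y Z : C) (i : Y ⟶ X) (p : X ⟶ Y) (j : Z ⟶ X) (q : X ⟶ Z),
      i ≫ p = 𝟙 Y ∧ j ≫ q = 𝟙 Z ∧ p ≫ i = e ∧ q ≫ j = 𝟙 X - e ∧ i ≫ q = 0 ∧ j ≫ p = 0 := by
  obtain ⟨Y, i, p, hi, hp⟩ := IsIdempotentComplete.idempotents_split X e he
  obtain ⟨Z, j, q, hj, hq⟩ := IsIdempotentComplete.idempotents_split X (𝟙 X - e)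
    (Idempotents.idem_of_id_sub_idem e he)
  refine ⟨Y, Z, i, p, j, q, hi, hj, hp, hq, ?_, ?_⟩
  · calc i ≫ q = (i ≫ p) ≫ i ≫ (q ≫ j) ≫ q := by simp [hi, hj]
      _ = i ≫ (p ≫ i) ≫ (𝟙 X - e) ≫ q := by simp [hq]
      _ = 0 := by rw [hp]; simp [reassoc_of% he]
  · calc j ≫ p = (j ≫ q) ≫ j ≫ (p ≫ i) ≫ p := by simp [hi, hj]
      _ = j ≫ (q ≫ j) ≫ e ≫ p := by simp [hp]
      _ = 0 := by rw [hq]; simp [reassoc_of% he]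

/-- Idempotents depend only on the endomorphism ring, so this form of indecomposability passes
freely between `Cₙ` and the category of all complexes. -/
theorem hasTrivialIdempotents_of_indecomposable [IsIdempotentComplete C] [HasBinaryBiproducts C]
    {X : C} (hX : Indecomposable X) : HasTrivialIdempotents X := by
  intro e he
  obtain ⟨Y, Z, i, p, j, q, hi, hj, hp, hq, hiq, hjp⟩ := exists_splitting_of_idempotent e he
  have hs : p ≫ i + q ≫ j = 𝟙 X := by rw [hp, hq]; abel
  rcases hX.2 Y Z
    { hom := biprod.lift p q
      inv := biprod.desc i j
      hom_inv_id := by simp [hs]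
      inv_hom_id := by ext <;> simp [hi, hj, hiq, hjp] } with h | h
  · left; rw [← hp, h.eq_of_tgt p 0, zero_comp]
  · right
    rw [h.eq_of_tgt q 0, zero_comp] at hq
    exact (sub_eq_zero.1 hq.symm).symm

end Idempotents

theorem isZero_of_retract {C : Type*} [Category C] [HasZeroMorphisms C] {X Y : C} (i : X ⟶ Y)
    (r : Y ⟶ X) (h : i ≫ r = 𝟙 X) (hY : IsZero Y) : IsZero X := by
  rw [IsZero.iff_id_eq_zero, ← h, hY.eq_of_tgt i 0, zero_comp]

section Algebra

variable (Λ : Type w) [Ring Λ]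

instance : IsIdempotentComplete (ProjMod Λ) :=
  isIdempotentComplete_fullSubcategory _ fun {X Y} i r h ⟨_, _⟩ => by
    have hr : ∀ x, r.hom (i.hom x) = x := fun x => congrArg (fun f => f.hom x) h
    exact ⟨Module.Finite.of_surjective r.hom fun x => ⟨_, hr x⟩,
      Module.Projective.of_split i.hom r.hom (LinearMap.ext hr)⟩

instance (n : ℕ) : IsIdempotentComplete (FixedSizeComplex Λ n) :=
  isIdempotentComplete_fullSubcategory _ fun i r h hY k hk =>
    isZero_of_retract (i.f k) (r.f k)
      (by rw [← HomologicalComplex.comp_f, h, HomologicalComplex.id_f]) (hY k hk)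

variable {Λ}

theorem subsingleton_of_isZero {M : ProjMod Λ} (h : IsZero M) : Subsingleton M.obj := by
  refine ⟨fun x y => ?_⟩
  have h1 : (𝟙 M : M ⟶ M) = 0 := h.eq_of_src _ _
  have h2 : ∀ x : M.obj, x = 0 := fun x => congrArg (fun f : M ⟶ M => f.hom.hom x) h1
  rw [h2 x, h2 y]

/-! ### Fitting's lemma -/

/-- Makes the degreewise Fitting projections into a morphism of complexes. -/
theorem projection_commute {R M N : Type*} [Ring R] [AddCommGroup M] [AddCommGroup N] [Module R M]
    [Module R N] {p q : Submodule R M} {p' q' : Submodule R N} (h : IsCompl p q)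
    (h' : IsCompl p' q') (d : M →ₗ[R] N) (hp : ∀ x ∈ p, d x ∈ p') (hq : ∀ x ∈ q, d x ∈ q') (x : M) :
    p'.projection q' h' (d x) = d (p.projection q h x) := by
  obtain ⟨y, hy, z, hz, rfl⟩ := Submodule.mem_sup.1 (h.sup_eq_top ▸ Submodule.mem_top (x := x))
  rw [map_add, map_add, map_add, Submodule.projection_apply_of_mem_left h hy,
    Submodule.projection_apply_of_mem_right h hz,
    Submodule.projection_apply_of_mem_left h' (hp y hy),
    Submodule.projection_apply_of_mem_right h' (hq z hz), add_zero, add_zero]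

theorem isIso_of_bijective {M N : ProjMod Λ} (f : M ⟶ N)
    (hf : Function.Bijective f.hom.hom) : IsIso f := by
  rw [← ObjectProperty.isIso_hom_iff]
  exact (ConcreteCategory.isIso_iff_bijective f.hom).2 hf

/-- Each cell is the direct sum of the image and the kernel of a high power of φ. By boundedness one
exponent serves all degrees, so the projections form an idempotent of the complex, which must be 0
or 1. -/
theorem isIso_or_isNilpotent [IsArtinianRing Λᵐᵒᵖ] {X : ProjComplex Λ} {a b : ℤ}
    (hb : ∀ i : ℤ, i < a ∨ b < i → IsZero (X.X i)) (hX : HasTrivialIdempotents X) (φ : X ⟶ X) :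
    IsIso φ ∨ IsNilpotent (show End X from φ) := by
  let F (i : ℤ) : Module.End Λᵐᵒᵖ (X.X i).obj := (φ.f i).hom.hom
  have hd1 (i j : ℤ) (x : (X.X i).obj) :
      F j ((X.d i j).hom.hom x) = (X.d i j).hom.hom (F i x) :=
    (congrArg (fun f : X.X i ⟶ X.X j => f.hom.hom x) (φ.comm i j)).symm
  have hd (i j : ℤ) (m : ℕ) : ∀ x : (X.X i).obj,
      (F j ^ m) ((X.d i j).hom.hom x) = (X.d i j).hom.hom ((F i ^ m) x) := by
    induction m with
    | zero => intro x; rfl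
    | succ m ih => intro x; rw [pow_succ, pow_succ, Module.End.mul_apply, Module.End.mul_apply,
        hd1, ih]
  have hfit : ∃ m : ℕ, m ≠ 0 ∧
      ∀ i, IsCompl (LinearMap.range (F i ^ m)) (LinearMap.ker (F i ^ m)) := by
    have h (i : ℤ) : ∀ᶠ m in Filter.atTop,
        IsCompl (LinearMap.ker (F i ^ m)) (LinearMap.range (F i ^ m)) := by
      obtain ⟨_, _⟩ := (X.X i).property
      exact LinearMap.eventually_isCompl_ker_pow_range_pow (F i)
    have h' := (Filter.eventually_all_finset (Finset.Icc a b)).2 fun i _ => h i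
    -- A nonzero exponent is needed so that bijectivity of `F i ^ m` descends to `F i`.
    obtain ⟨m, hm, hm0⟩ := (h'.and (Filter.eventually_ne_atTop 0)).exists
    refine ⟨m, hm0, fun i => ?_⟩
    by_cases hi : i ∈ Finset.Icc a b
    · exact (hm i hi).symm
    · have := subsingleton_of_isZero (hb i (by rw [Finset.mem_Icc] at hi; omega))
      exact ⟨disjoint_iff.2 (Subsingleton.elim _ _), codisjoint_iff.2 (Subsingleton.elim _ _)⟩
  obtain ⟨m, hm0, hm⟩ := hfit
  let E (i : ℤ) : X.X i ⟶ X.X i := ObjectProperty.homMk (ModuleCat.ofHom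
    ((LinearMap.range (F i ^ m)).projection (LinearMap.ker (F i ^ m)) (hm i)))
  let e : X ⟶ X :=
    { f := E
      comm' := fun i j _ => by
        ext x
        refine (projection_commute (hm i) (hm j) (X.d i j).hom.hom ?_ ?_ x).symm
        · rintro _ ⟨x, rfl⟩
          exact ⟨_, hd i j m x⟩
        · intro x hx
          rw [LinearMap.mem_ker] at hx ⊢
          rw [hd, hx, map_zero] }
  have he : e ≫ e = e := by
    ext i x
    exact LinearMap.congr_fun (Submodule.isIdempotentElem_projection (hm i)) x
  rcases hX e he with h | h
  · right
    have hz (i : ℤ) : F i ^ m = 0 := by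
      have h1 : E i = 0 := congrArg (fun f : X ⟶ X => f.f i) h
      have h2 : LinearMap.range ((LinearMap.range (F i ^ m)).projection _ (hm i)) = ⊥ := by
        rw [LinearMap.range_eq_bot]
        exact congrArg (fun f : X.X i ⟶ X.X i => f.hom.hom) h1
      rwa [Submodule.range_projection, LinearMap.range_eq_bot] at h2
    have hp (k : ℕ) (i : ℤ) :
        (((show End X from φ) ^ k : End X) : X ⟶ X).f i =
          ObjectProperty.homMk (ModuleCat.ofHom (F i ^ k)) := by
      induction k with
      | zero => rfl
      | succ k ih =>
        rw [pow_succ, End.mul_def, HomologicalComplex.comp_f, ih]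
        rfl
    refine ⟨m, HomologicalComplex.hom_ext _ _ fun i => ?_⟩
    rw [hp, hz]
    rfl
  · left
    have (i : ℤ) : IsIso (φ.f i) := by
      refine isIso_of_bijective _ ?_
      have h1 : E i = 𝟙 _ := congrArg (fun f : X ⟶ X => f.f i) h
      have h2 : LinearMap.ker ((LinearMap.range (F i ^ m)).projection _ (hm i)) = ⊥ := by
        rw [LinearMap.ker_eq_bot']
        intro x hx
        exact (congrArg (fun f : X.X i ⟶ X.X i => f.hom.hom x) h1).symm.trans hx
      rw [Submodule.ker_projection] at h2
      have h3 := (hm i).sup_eq_top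
      rw [h2, sup_bot_eq, LinearMap.range_eq_top] at h3
      rw [LinearMap.ker_eq_bot] at h2
      obtain ⟨k, rfl⟩ := Nat.exists_eq_succ_of_ne_zero hm0
      rw [pow_succ, Module.End.mul_eq_comp] at h2
      rw [pow_succ', Module.End.mul_eq_comp] at h3
      exact ⟨Function.Injective.of_comp h2, Function.Surjective.of_comp h3⟩
    exact HomologicalComplex.Hom.isIso_of_components φ

end Algebra

section Complexes

variable {V : Type*} [Category V] [Preadditive V]

/-! ### Null-homotopic morphisms -/

/-- A morphism of complexes which is homotopic to zero. -/
def IsNullHomotopic {X Y : CochainComplex V ℤ} (f : X ⟶ Y) : Prop :=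
  ∃ s : ∀ i j, X.X j ⟶ Y.X i, ∀ i j k, i + 1 = j → j + 1 = k →
    f.f j = X.d j k ≫ s j k + s i j ≫ Y.d i j

theorem isNullHomotopic_iff {X Y : CochainComplex V ℤ} (f : X ⟶ Y) :
    IsNullHomotopic f ↔ Nonempty (Homotopy f 0) := by
  constructor
  · rintro ⟨s, hs⟩
    refine ⟨{ hom := fun p q => if q + 1 = p then s q p else 0, zero := ?_, comm := ?_ }⟩
    · intro p q hpq
      exact if_neg hpq
    · intro j
      rw [dNext_eq _ (show (ComplexShape.up ℤ).Rel j (j + 1) from rfl),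
        prevD_eq _ (show (ComplexShape.up ℤ).Rel (j - 1) j from sub_add_cancel j 1),
        if_pos rfl, if_pos (sub_add_cancel j 1), hs (j - 1) j (j + 1) (by omega) rfl]
      simp
  · rintro ⟨h⟩
    refine ⟨fun i j => h.hom j i, fun i j k hij hjk => ?_⟩
    have := h.comm j
    rwa [dNext_eq _ (show (ComplexShape.up ℤ).Rel j k from hjk),
      prevD_eq _ (show (ComplexShape.up ℤ).Rel i j from hij), HomologicalComplex.zero_f,
      add_zero] at this

theorem IsNullHomotopic.comp_left {X Y Z : CochainComplex V ℤ} {g : Y ⟶ Z}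
    (hg : IsNullHomotopic g) (f : X ⟶ Y) : IsNullHomotopic (f ≫ g) := by
  obtain ⟨s, hs⟩ := hg
  refine ⟨fun i j => f.f j ≫ s i j, fun i j k hij hjk => ?_⟩
  rw [HomologicalComplex.comp_f, hs i j k hij hjk]
  simp

theorem IsNullHomotopic.comp_right {X Y Z : CochainComplex V ℤ} {f : X ⟶ Y}
    (hf : IsNullHomotopic f) (g : Y ⟶ Z) : IsNullHomotopic (f ≫ g) := by
  obtain ⟨s, hs⟩ := hf
  refine ⟨fun i j => s i j ≫ g.f i, fun i j k hij hjk => ?_⟩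
  rw [HomologicalComplex.comp_f, hs i j k hij hjk]
  simp

/-! ### Indecomposable complexes with a differential that splits -/

/-- The maps d s in degree i, s d in degree j and 0 elsewhere form an idempotent of the complex. It
is nonzero because d is, hence it is the identity. -/
theorem isZero_of_split_d {X : CochainComplex V ℤ} (hX : HasTrivialIdempotents X) {i j : ℤ}
    (hij : i + 1 = j) (s : X.X j ⟶ X.X i) (hs : X.d i j ≫ s ≫ X.d i j = X.d i j)
    (hd : X.d i j ≠ 0) :
    X.d i j ≫ s = 𝟙 _ ∧ s ≫ X.d i j = 𝟙 _ ∧ ∀ k, k ≠ i → k ≠ j → IsZero (X.X k) := by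
  have hji : j ≠ i := by omega
  obtain ⟨E, hEi, hEj, hE⟩ : ∃ E : ∀ k, X.X k ⟶ X.X k, E i = X.d i j ≫ s ∧ E j = s ≫ X.d i j ∧
      ∀ k, k ≠ i → k ≠ j → E k = 0 := by
    refine ⟨Function.update (Function.update 0 i (X.d i j ≫ s)) j (s ≫ X.d i j), ?_, ?_, ?_⟩
    · simp [hji.symm]
    · simp
    · intro k h1 h2
      simp [h1, h2]
  let e : X ⟶ X :=
    { f := E
      comm' := fun k l hkl => by
        change k + 1 = l at hkl
        by_cases hki : k = i
        · obtain rfl := hki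
          obtain rfl : j = l := by omega
          rw [hEi, hEj, Category.assoc, hs]
        · by_cases hkj : k = j
          · subst hkj
            rw [hEj, hE l (by omega) (by omega)]
            simp
          · rw [hE k hki hkj, zero_comp]
            by_cases hli : l = i
            · subst hli
              rw [hEi]
              simp
            · rw [hE l hli (by omega), comp_zero] }
  have he : e ≫ e = e := by
    ext k
    change E k ≫ E k = E k
    by_cases hki : k = i
    · subst hki
      rw [hEi, Category.assoc, reassoc_of% hs]
    · by_cases hkj : k = j
      · subst hkj
        rw [hEj, Category.assoc, hs]
      · rw [hE k hki hkj, zero_comp]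
  rcases hX e he with h | h
  · refine absurd ?_ hd
    have h1 : E i = 0 := congrArg (fun f : X ⟶ X => f.f i) h
    rw [← hs, ← Category.assoc, ← hEi, h1, zero_comp]
  · have h1 (k : ℤ) : E k = 𝟙 _ := congrArg (fun f : X ⟶ X => f.f k) h
    refine ⟨hEi ▸ h1 i, hEj ▸ h1 j, fun k hki hkj => ?_⟩
    rw [IsZero.iff_id_eq_zero, ← h1, hE k hki hkj]

/-- A contraction s satisfies d s d = d. If both differentials at degree a vanish, so does the
identity there; otherwise the complex lives in degree a and one neighbour, which is not b. -/
theorem isZero_of_contractible {X : CochainComplex V ℤ} (hX : HasTrivialIdempotents X)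
    (hc : IsNullHomotopic (𝟙 X)) {a b : ℤ} (hab : a + 1 < b) :
    IsZero (X.X a) ∨ IsZero (X.X b) := by
  obtain ⟨s, hs⟩ := hc
  have hdsd (i j : ℤ) (hij : i + 1 = j) : X.d i j ≫ s i j ≫ X.d i j = X.d i j := by
    have h := hs i j (j + 1) hij rfl
    rw [HomologicalComplex.id_f] at h
    calc X.d i j ≫ s i j ≫ X.d i j
        = X.d i j ≫ (X.d j (j + 1) ≫ s j (j + 1) + s i j ≫ X.d i j) := by simp
      _ = X.d i j := by rw [← h, Category.comp_id]
  by_cases h1 : X.d a (a + 1) = 0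
  · by_cases h2 : X.d (a - 1) a = 0
    · left
      rw [IsZero.iff_id_eq_zero, ← HomologicalComplex.id_f,
        hs (a - 1) a (a + 1) (by omega) rfl, h1, h2, zero_comp, comp_zero, add_zero]
    · right
      exact (isZero_of_split_d hX (by omega) _ (hdsd (a - 1) a (by omega)) h2).2.2 b (by omega)
        (by omega)
  · right
    exact (isZero_of_split_d hX rfl _ (hdsd a _ rfl) h1).2.2 b (by omega) (by omega)

end Complexes

section Algebra

variable {Λ : Type w} [Ring Λ]

/-! ### Indecomposable complexes in the homotopy category -/

theorem isMinimal_of_hasTrivialIdempotents {X : ProjComplex Λ} (hX : HasTrivialIdempotents X)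
    (hc : ¬ IsNullHomotopic (𝟙 X)) : IsMinimal X := by
  rintro Z W ⟨φ⟩ hZ
  rcases hX (φ.hom ≫ biprod.fst ≫ biprod.inl ≫ φ.inv) (by simp) with h | h
  · rw [IsZero.iff_id_eq_zero]
    calc 𝟙 Z = biprod.inl ≫ φ.inv ≫ (φ.hom ≫ biprod.fst ≫ biprod.inl ≫ φ.inv) ≫ φ.hom ≫
          biprod.fst := by simp
      _ = 0 := by rw [h]; simp
  · refine absurd ?_ hc
    rw [← h]
    have := (((isNullHomotopic_iff _).2 hZ).comp_left (φ.hom ≫ biprod.fst)).comp_right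
      (biprod.inl ≫ φ.inv)
    simpa using this

/-- An idempotent up to homotopy lifts to a chain endomorphism, perhaps not idempotent, but
invertible or nilpotent by Fitting. Its class is accordingly 1 or 0. -/
theorem indecomposable_quotient [IsArtinianRing Λᵐᵒᵖ] {X : ProjComplex Λ} {a b : ℤ}
    (hb : ∀ i : ℤ, i < a ∨ b < i → IsZero (X.X i)) (hX : HasTrivialIdempotents X)
    (hc : ¬ IsNullHomotopic (𝟙 X))
    (h : (isBounded Λ).strictMap
      (HomotopyCategory.quotient (ProjMod Λ) (ComplexShape.up ℤ))
        ((HomotopyCategory.quotient (ProjMod Λ) (ComplexShape.up ℤ)).obj X)) :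
    Indecomposable (⟨_, h⟩ : BoundedHomotopyCategory Λ) := by
  let Q := HomotopyCategory.quotient (ProjMod Λ) (ComplexShape.up ℤ)
  refine ⟨fun hz => hc ?_, fun U W φ => ?_⟩
  · rw [isNullHomotopic_iff, ← HomotopyCategory.quotient_map_eq_zero_iff, Q.map_id]
    exact congrArg (fun f => f.hom) ((IsZero.iff_id_eq_zero _).1 hz)
  · let e := φ.hom ≫ biprod.fst ≫ biprod.inl ≫ φ.inv
    have he : e ≫ e = e := by simp [e]
    obtain ⟨ψ, hψ⟩ := Q.map_surjective e.hom
    rcases isIso_or_isNilpotent hb hX ψ with hi | ⟨m, hm⟩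
    · right
      have h1 : IsIso e.hom := by rw [← hψ]; infer_instance
      have h2 : IsIso e := (ObjectProperty.isIso_hom_iff e).1 h1
      have h3 : e = 𝟙 _ := by rw [← cancel_epi e, he, Category.comp_id]
      rw [IsZero.iff_id_eq_zero]
      calc 𝟙 W = biprod.inr ≫ φ.inv ≫ 𝟙 _ ≫ φ.hom ≫ biprod.snd := by simp
        _ = 0 := by rw [← h3]; simp [e]
    · left
      have h1 (k : ℕ) : Q.map ((show End X from ψ) ^ (k + 1) : End X) = e.hom := by
        induction k with
        | zero => rw [zero_add, pow_one]; exact hψ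
        | succ k ih =>
          rw [pow_succ, End.mul_def, Q.map_comp, ih, hψ, ← ObjectProperty.FullSubcategory.comp_hom,
            he]
      have h2 : e = 0 := by
        ext
        rw [← h1 m, pow_succ, hm, zero_mul]
        exact Q.map_zero _ _
      rw [IsZero.iff_id_eq_zero]
      calc 𝟙 U = biprod.inl ≫ φ.inv ≫ e ≫ φ.hom ≫ biprod.fst := by simp [e]
        _ = 0 := by rw [h2]; simp

/-- An indecomposable complex whose support is contained in an interval that is longer than the
strong global dimension vanishes at one of the ends of the interval. -/
theorem isZero_of_strongGlobalDimension_le [IsArtinianRing Λᵐᵒᵖ] {η : ℕ}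
    (hΛ : strongGlobalDimension Λ ≤ η) {X : ProjComplex Λ} {a b : ℤ}
    (hb : ∀ i : ℤ, i < a ∨ b < i → IsZero (X.X i)) (hX : HasTrivialIdempotents X)
    (hab : a + 1 < b) (hη : a + η < b) : IsZero (X.X a) ∨ IsZero (X.X b) := by
  by_cases hc : IsNullHomotopic (𝟙 X)
  · exact isZero_of_contractible hX hc hab
  · by_contra! h
    have hp := ObjectProperty.strictMap_obj (isBounded Λ)
      (HomotopyCategory.quotient (ProjMod Λ) (ComplexShape.up ℤ)) ⟨a, b, hb⟩
    have h1 : (((b - a).toNat : ℕ) : ℕ∞) ≤ strongGlobalDimension Λ :=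
      le_sSup ⟨⟨_, hp⟩, (b - a).toNat, indecomposable_quotient hb hX hc hp,
        ⟨X, isMinimal_of_hasTrivialIdempotents hX hc, ⟨Iso.refl _⟩, a, b, by omega, h.1, h.2, hb⟩,
        rfl⟩
    have h2 := h1.trans hΛ
    rw [Nat.cast_le] at h2
    omega

end Algebra

section Algebra

variable {Λ : Type w} [Ring Λ]

/-! ### Decompositions of complexes -/

/-- The sum of the composition lengths of the cells of a complex in the degrees `a, …, b`. -/
noncomputable def totalLength (a b : ℤ) (X : ProjComplex Λ) : ℕ :=
  ∑ i ∈ Finset.Icc a b, (Module.length Λᵐᵒᵖ (X.X i).obj).toNat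

/-- The induction measure for splitting a complex into smaller summands. -/
theorem totalLength_lt [IsArtinianRing Λᵐᵒᵖ] {a b : ℤ} {X Y Z : ProjComplex Λ} {i : Y ⟶ X}
    {p : X ⟶ Y} {j : Z ⟶ X} {q : X ⟶ Z} (hip : i ≫ p = 𝟙 Y) (hjq : j ≫ q = 𝟙 Z) (hiq : i ≫ q = 0)
    (hb : ∀ k : ℤ, k < a ∨ b < k → IsZero (X.X k)) (hZ : ¬ IsZero Z) :
    totalLength a b Y < totalLength a b X := by
  have hinj (k : ℤ) : Function.Injective (i.f k).hom.hom :=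
    Function.LeftInverse.injective (g := (p.f k).hom.hom)
      fun x => congrArg (fun f : Y ⟶ Y => (f.f k).hom.hom x) hip
  have hne (k : ℤ) : Module.length Λᵐᵒᵖ (X.X k).obj ≠ ⊤ := by
    obtain ⟨_, _⟩ := (X.X k).property
    exact Module.length_ne_top
  obtain ⟨k, hk⟩ : ∃ k, ¬ IsZero (Z.X k) := by
    by_contra! h
    refine hZ ?_
    rw [IsZero.iff_id_eq_zero]
    ext k : 1
    exact (h k).eq_of_src _ _
  refine Finset.sum_lt_sum (fun l _ => ?_) ⟨k, ?_, ?_⟩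
  · exact ENat.toNat_le_toNat (Module.length_le_of_injective _ (hinj l)) (hne l)
  · by_contra hk'
    refine hk (isZero_of_retract (j.f k) (q.f k) ?_ (hb k (by rw [Finset.mem_Icc] at hk'; omega)))
    rw [← HomologicalComplex.comp_f, hjq, HomologicalComplex.id_f]
  · obtain ⟨_, _⟩ := (X.X k).property
    have hr : LinearMap.range (i.f k).hom.hom ≠ ⊤ := by
      intro h
      refine hk ((IsZero.iff_id_eq_zero _).2 ?_)
      have hq : q.f k = 0 := by
        ext x
        obtain ⟨y, rfl⟩ := LinearMap.range_eq_top.1 h x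
        exact congrArg (fun f : Y ⟶ Z => (f.f k).hom.hom y) hiq
      rw [← HomologicalComplex.id_f, ← hjq, HomologicalComplex.comp_f, hq, comp_zero]
    have h1 := Submodule.length_lt hr
    rw [← (LinearEquiv.ofInjective _ (hinj k)).length_eq] at h1
    rwa [← ENat.natCast_lt_natCast, ENat.natCast_toNat h1.ne_top, ENat.natCast_toNat (hne k)]

/-- A decomposition `C = A ⊕ B` of a complex. -/
structure Decomposition {V : Type*} [Category V] [Preadditive V] (C A B : V) where
  inA : A ⟶ C
  prA : C ⟶ A
  inB : B ⟶ C
  prB : C ⟶ B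
  inA_prA : inA ≫ prA = 𝟙 A
  inB_prB : inB ≫ prB = 𝟙 B
  inA_prB : inA ≫ prB = 0
  inB_prA : inB ≫ prA = 0
  total : prA ≫ inA + prB ≫ inB = 𝟙 C

/-- A complex whose support is contained in an interval that is longer than the strong global
dimension is the direct sum of a complex that vanishes at the lower end of the interval and a
complex that vanishes at its upper end. -/
theorem exists_decomposition [IsArtinianRing Λᵐᵒᵖ] {η : ℕ}
    (hΛ : strongGlobalDimension Λ ≤ η) {a b : ℤ} (hab : a + 1 < b) (hη : a + η < b) (N : ℕ) :
    ∀ C : ProjComplex Λ, totalLength a b C < N →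
    (∀ i : ℤ, i < a ∨ b < i → IsZero (C.X i)) →
    ∃ A B : ProjComplex Λ, IsZero (A.X a) ∧ IsZero (B.X b) ∧ Nonempty (Decomposition C A B) := by
  induction N with
  | zero => intro C h; omega
  | succ N ih =>
    intro C hN hb
    by_cases hC : HasTrivialIdempotents C
    · obtain ⟨O, hO⟩ := HasZeroObject.zero (C := ProjComplex Λ)
      have hz (i : ℤ) : IsZero (O.X i) := by
        rw [IsZero.iff_id_eq_zero, ← HomologicalComplex.id_f, hO.eq_of_src (𝟙 O) 0,
          HomologicalComplex.zero_f]
      rcases isZero_of_strongGlobalDimension_le hΛ hb hC hab hη with h | h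
      · exact ⟨C, O, h, hz _, ⟨⟨𝟙 C, 𝟙 C, 0, 0, by simp, hO.eq_of_src _ _, by simp,
          by simp, by simp⟩⟩⟩
      · exact ⟨O, C, hz _, h, ⟨⟨0, 0, 𝟙 C, 𝟙 C, hO.eq_of_src _ _, by simp, by simp,
          by simp, by simp⟩⟩⟩
    · rw [HasTrivialIdempotents] at hC
      push Not at hC
      obtain ⟨e, he, he0, he1⟩ := hC
      obtain ⟨Y, Z, i, p, j, q, hi, hj, hp, hq, hiq, hjp⟩ := exists_splitting_of_idempotent e he
      have hY : ¬ IsZero Y := fun h => he0 (by rw [← hp, h.eq_of_tgt p 0, zero_comp])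
      have hZ : ¬ IsZero Z := fun h => he1 (by
        rw [h.eq_of_tgt q 0, zero_comp] at hq; exact (sub_eq_zero.1 hq.symm).symm)
      have hs : p ≫ i + q ≫ j = 𝟙 C := by rw [hp, hq]; abel
      have hret {W : ProjComplex Λ} (i : W ⟶ C) (p : C ⟶ W) (h : i ≫ p = 𝟙 W) (k : ℤ)
          (hk : k < a ∨ b < k) : IsZero (W.X k) :=
        isZero_of_retract (i.f k) (p.f k)
          (by rw [← HomologicalComplex.comp_f, h, HomologicalComplex.id_f]) (hb k hk)
      obtain ⟨A, B, hA, hB, ⟨D⟩⟩ := ih Y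
        ((totalLength_lt hi hj hiq hb hZ).trans_le (Nat.le_of_lt_succ hN)) (hret i p hi)
      obtain ⟨A', B', hA', hB', ⟨D'⟩⟩ := ih Z
        ((totalLength_lt hj hi hjp hb hY).trans_le (Nat.le_of_lt_succ hN)) (hret j q hj)
      refine ⟨A ⊞ A', B ⊞ B', isZero_biprod_X A A' a hA hA', isZero_biprod_X B B' b hB hB', ⟨
        { inA := biprod.desc (D.inA ≫ i) (D'.inA ≫ j)
          prA := biprod.lift (p ≫ D.prA) (q ≫ D'.prA)
          inB := biprod.desc (D.inB ≫ i) (D'.inB ≫ j)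
          prB := biprod.lift (p ≫ D.prB) (q ≫ D'.prB)
          inA_prA := ?_
          inB_prB := ?_
          inA_prB := ?_
          inB_prA := ?_
          total := ?_ }⟩⟩
      · refine biprod.hom_ext' _ _ (biprod.hom_ext _ _ ?_ ?_) (biprod.hom_ext _ _ ?_ ?_) <;>
          simp [reassoc_of% hi, reassoc_of% hj, reassoc_of% hiq, reassoc_of% hjp, D.inA_prA,
            D'.inA_prA]
      · refine biprod.hom_ext' _ _ (biprod.hom_ext _ _ ?_ ?_) (biprod.hom_ext _ _ ?_ ?_) <;>
          simp [reassoc_of% hi, reassoc_of% hj, reassoc_of% hiq, reassoc_of% hjp, D.inB_prB,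
            D'.inB_prB]
      · refine biprod.hom_ext' _ _ (biprod.hom_ext _ _ ?_ ?_) (biprod.hom_ext _ _ ?_ ?_) <;>
          simp [reassoc_of% hi, reassoc_of% hj, reassoc_of% hiq, reassoc_of% hjp, D.inA_prB,
            D'.inA_prB]
      · refine biprod.hom_ext' _ _ (biprod.hom_ext _ _ ?_ ?_) (biprod.hom_ext _ _ ?_ ?_) <;>
          simp [reassoc_of% hi, reassoc_of% hj, reassoc_of% hiq, reassoc_of% hjp, D.inB_prA,
            D'.inB_prA]
      · calc _ = p ≫ (D.prA ≫ D.inA + D.prB ≫ D.inB) ≫ i +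
              q ≫ (D'.prA ≫ D'.inA + D'.prB ≫ D'.inB) ≫ j := by
              simp only [biprod.lift_desc, Category.assoc, Preadditive.comp_add,
                Preadditive.add_comp]
              abel
          _ = 𝟙 C := by rw [D.total, D'.total, Category.id_comp, Category.id_comp, hs]

end Algebra

section Complexes

variable {V : Type*} [Category V] [Preadditive V]

/-! ### Null-homotopic identities -/

theorem isNullHomotopic_id_of_isNilpotent {X : CochainComplex V ℤ} {v : X ⟶ X}
    (hv : IsNullHomotopic (𝟙 X - v)) (hn : IsNilpotent (show End X from v)) :
    IsNullHomotopic (𝟙 X) := by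
  let Q := HomotopyCategory.quotient V (ComplexShape.up ℤ)
  rw [isNullHomotopic_iff, ← HomotopyCategory.quotient_map_eq_zero_iff] at hv ⊢
  have h1 : Q.map v = 𝟙 _ := by
    rw [Functor.map_sub, CategoryTheory.Functor.map_id, sub_eq_zero] at hv
    exact hv.symm
  obtain ⟨m, hm⟩ := hn
  have h2 (k : ℕ) : Q.map ((show End X from v) ^ k : End X) = 𝟙 _ := by
    induction k with
    | zero => exact Q.map_id X
    | succ k ih => rw [pow_succ, End.mul_def, Q.map_comp, ih, Category.comp_id]; exact h1
  have h3 := h2 m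
  rw [hm] at h3
  change Q.map (𝟙 X) = 0
  rw [Q.map_id, ← h3]
  exact Q.map_zero _ _

theorem isNilpotent_comp {C : Type*} [Category C] [Preadditive C] {X Y : C} (f : X ⟶ Y) (g : Y ⟶ X)
    (h : IsNilpotent (show End X from f ≫ g)) : IsNilpotent (show End Y from g ≫ f) := by
  obtain ⟨m, hm⟩ := h
  refine ⟨m + 1, ?_⟩
  have h1 (k : ℕ) : ((show End Y from g ≫ f) ^ (k + 1) : End Y) =
      g ≫ ((show End X from f ≫ g) ^ k : End X) ≫ f := by
    induction k with
    | zero =>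
      rw [zero_add, pow_one, pow_zero]
      exact (congrArg (g ≫ ·) (Category.id_comp f)).symm
    | succ k ih =>
      rw [pow_succ, End.mul_def, ih, pow_succ, End.mul_def]
      simp only [Category.assoc]
  rw [h1, hm]
  simp only [zero_comp, comp_zero]

/-- Maps of degree one and minus one between two complexes that anticommute with the differentials
have composites that are endomorphisms of the complexes. -/
theorem exists_endomorphisms {X B : CochainComplex V ℤ} (T : ∀ i j, B.X i ⟶ X.X j)
    (t : ∀ i j, X.X j ⟶ B.X i)
    (hT : ∀ i j k, i + 1 = j → j + 1 = k → T i j ≫ X.d j k = -(B.d i j ≫ T j k))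
    (ht : ∀ i j k, i + 1 = j → j + 1 = k → t i j ≫ B.d i j = -(X.d j k ≫ t j k)) :
    ∃ (u : X ⟶ X) (v : B ⟶ B), (∀ i j, i + 1 = j → u.f j = t i j ≫ T i j) ∧
      (∀ i j, i + 1 = j → v.f i = T i j ≫ t i j) ∧
      (IsNilpotent (show End X from u) → IsNilpotent (show End B from v)) := by
  let u : X ⟶ X :=
    { f := fun j => t (j - 1) j ≫ T (j - 1) j
      comm' := fun j k hjk => by
        obtain rfl : j = k - 1 := by change j + 1 = k at hjk; omega
        have h1 := hT (k - 1 - 1) (k - 1) k (by omega) (by omega)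
        have h2 := ht (k - 1 - 1) (k - 1) k (by omega) (by omega)
        rw [Category.assoc, h1, Preadditive.comp_neg, reassoc_of% h2]
        simp }
  let v : B ⟶ B :=
    { f := fun i => T i (i + 1) ≫ t i (i + 1)
      comm' := fun i j hij => by
        obtain rfl : i + 1 = j := hij
        have h1 := hT i (i + 1) (i + 1 + 1) rfl rfl
        have h2 := ht i (i + 1) (i + 1 + 1) rfl rfl
        rw [Category.assoc, h2, Preadditive.comp_neg, reassoc_of% h1]
        simp }
  have hu (i j : ℤ) (hij : i + 1 = j) : u.f j = t i j ≫ T i j := by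
    obtain rfl : i = j - 1 := by omega
    rfl
  have hv (i j : ℤ) (hij : i + 1 = j) : v.f i = T i j ≫ t i j := by
    subst hij
    rfl
  refine ⟨u, v, hu, hv, fun ⟨m, hm⟩ => ⟨m + 1, ?_⟩⟩
  -- With u = t T and v = T t, in composition order, v^(k+1) = T u^k t; hence one extra power.
  have h1 (k : ℕ) (i j : ℤ) (hij : i + 1 = j) : ((show End B from v) ^ (k + 1) : End B).f i =
      T i j ≫ ((show End X from u) ^ k : End X).f j ≫ t i j := by
    induction k with
    | zero =>
      rw [zero_add, pow_one, pow_zero]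
      change v.f i = T i j ≫ (𝟙 X : X ⟶ X).f j ≫ t i j
      rw [hv i j hij, HomologicalComplex.id_f, Category.id_comp]
    | succ k ih =>
      rw [pow_succ, End.mul_def, HomologicalComplex.comp_f, ih, pow_succ, End.mul_def,
        HomologicalComplex.comp_f]
      change v.f i ≫ _ = T i j ≫ (u.f j ≫ _) ≫ _
      rw [hv i j hij, hu i j hij]
      simp only [Category.assoc]
  refine HomologicalComplex.hom_ext _ _ fun i => ?_
  rw [h1 m i (i + 1) rfl, hm]
  change _ ≫ (0 : X ⟶ X).f _ ≫ _ = (0 : B ⟶ B).f i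
  simp

/-! ### Twisted direct sums -/

section Twist

variable [HasBinaryBiproducts V] {A X : CochainComplex V ℤ} (θ : ∀ i j, A.X i ⟶ X.X j)
  (hθ : ∀ i j k, i + 1 = j → j + 1 = k → θ i j ≫ X.d j k = -(A.d i j ≫ θ j k))

/-- The direct sum of the cells of `A` and `X`, with the differential twisted by a map of degree
one from `A` to `X`. -/
noncomputable def twist : CochainComplex V ℤ where
  X i := A.X i ⊞ X.X i
  d i j := if i + 1 = j then
    biprod.map (A.d i j) (X.d i j) + biprod.fst ≫ θ i j ≫ biprod.inr else 0
  shape i j hij := if_neg hij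
  d_comp_d' i j k hij hjk := by
    change i + 1 = j at hij
    change j + 1 = k at hjk
    rw [if_pos hij, if_pos hjk]
    refine biprod.hom_ext' _ _ (biprod.hom_ext _ _ ?_ ?_) (biprod.hom_ext _ _ ?_ ?_) <;>
      simp [hθ i j k hij hjk]

variable {θ}

theorem twist_d {i j : ℤ} (hij : i + 1 = j) : (twist θ hθ).d i j =
    biprod.map (A.d i j) (X.d i j) + biprod.fst ≫ θ i j ≫ biprod.inr :=
  if_pos hij

theorem isZero_twist_X {i : ℤ} (hA : IsZero (A.X i)) (hX : IsZero (X.X i)) :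
    IsZero ((twist θ hθ).X i) :=
  (biprod_isZero_iff _ _).2 ⟨hA, hX⟩

/-- The morphism to a twisted direct sum with the given components. -/
noncomputable def twistLift {Z : CochainComplex V ℤ} (α : Z ⟶ A) (β : ∀ i, Z.X i ⟶ X.X i)
    (h : ∀ i j, i + 1 = j → β i ≫ X.d i j + α.f i ≫ θ i j = Z.d i j ≫ β j) :
    Z ⟶ twist θ hθ where
  f i := biprod.lift (α.f i) (β i)
  comm' i j hij := by
    change i + 1 = j at hij
    rw [twist_d hθ hij]
    change biprod.lift (α.f i) (β i) ≫ (biprod.map (A.d i j) (X.d i j) +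
      biprod.fst ≫ θ i j ≫ biprod.inr) = Z.d i j ≫ biprod.lift (α.f j) (β j)
    refine biprod.hom_ext _ _ ?_ ?_ <;> simp [← h i j hij]

/-- The morphism from a twisted direct sum with the given components. -/
noncomputable def twistDesc {Z : CochainComplex V ℤ} (α : ∀ i, A.X i ⟶ Z.X i) (β : X ⟶ Z)
    (h : ∀ i j, i + 1 = j → α i ≫ Z.d i j = A.d i j ≫ α j + θ i j ≫ β.f j) :
    twist θ hθ ⟶ Z where
  f i := biprod.desc (α i) (β.f i)
  comm' i j hij := by
    change i + 1 = j at hij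
    rw [twist_d hθ hij]
    change biprod.desc (α i) (β.f i) ≫ Z.d i j = (biprod.map (A.d i j) (X.d i j) +
      biprod.fst ≫ θ i j ≫ biprod.inr) ≫ biprod.desc (α j) (β.f j)
    refine biprod.hom_ext' _ _ ?_ ?_ <;> simp [h i j hij]

theorem twistLift_desc_f {Z Z' : CochainComplex V ℤ} (α : Z ⟶ A) (β : ∀ i, Z.X i ⟶ X.X i)
    (h : ∀ i j, i + 1 = j → β i ≫ X.d i j + α.f i ≫ θ i j = Z.d i j ≫ β j)
    (α' : ∀ i, A.X i ⟶ Z'.X i) (β' : X ⟶ Z')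
    (h' : ∀ i j, i + 1 = j → α' i ≫ Z'.d i j = A.d i j ≫ α' j + θ i j ≫ β'.f j) (i : ℤ) :
    (twistLift hθ α β h ≫ twistDesc hθ α' β' h').f i = α.f i ≫ α' i + β i ≫ β'.f i :=
  biprod.lift_desc

theorem exists_eq_twistLift {Z : CochainComplex V ℤ} (k : Z ⟶ twist θ hθ) :
    ∃ (α : Z ⟶ A) (β : ∀ i, Z.X i ⟶ X.X i)
      (h : ∀ i j, i + 1 = j → β i ≫ X.d i j + α.f i ≫ θ i j = Z.d i j ≫ β j),
      k = twistLift hθ α β h := by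
  let k' (i : ℤ) : Z.X i ⟶ A.X i ⊞ X.X i := k.f i
  have hk (i j : ℤ) (hij : i + 1 = j) : k' i ≫ (biprod.map (A.d i j) (X.d i j) +
      biprod.fst ≫ θ i j ≫ biprod.inr) = Z.d i j ≫ k' j := by
    have := k.comm i j
    rwa [twist_d hθ hij] at this
  refine ⟨{ f := fun i => k' i ≫ biprod.fst, comm' := fun i j hij => ?_ },
    fun i => k' i ≫ biprod.snd, fun i j hij => ?_, ?_⟩
  · have := congrArg (· ≫ biprod.fst) (hk i j hij)
    simpa using this
  · have := congrArg (· ≫ biprod.snd) (hk i j hij)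
    simpa using this
  · refine HomologicalComplex.hom_ext _ _ fun i => ?_
    change k' i = biprod.lift (k' i ≫ biprod.fst) (k' i ≫ biprod.snd)
    refine biprod.hom_ext _ _ ?_ ?_ <;> simp

theorem exists_eq_twistDesc {Z : CochainComplex V ℤ} (r : twist θ hθ ⟶ Z) :
    ∃ (α : ∀ i, A.X i ⟶ Z.X i) (β : X ⟶ Z)
      (h : ∀ i j, i + 1 = j → α i ≫ Z.d i j = A.d i j ≫ α j + θ i j ≫ β.f j),
      r = twistDesc hθ α β h := by
  let r' (i : ℤ) : A.X i ⊞ X.X i ⟶ Z.X i := r.f i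
  have hr (i j : ℤ) (hij : i + 1 = j) : r' i ≫ Z.d i j = (biprod.map (A.d i j) (X.d i j) +
      biprod.fst ≫ θ i j ≫ biprod.inr) ≫ r' j := by
    have := r.comm i j
    rwa [twist_d hθ hij] at this
  refine ⟨fun i => biprod.inl ≫ r' i,
    { f := fun i => biprod.inr ≫ r' i, comm' := fun i j hij => ?_ }, fun i j hij => ?_, ?_⟩
  · have := congrArg (biprod.inr ≫ ·) (hr i j hij)
    simpa using this
  · have := congrArg (biprod.inl ≫ ·) (hr i j hij)
    simpa using this
  · refine HomologicalComplex.hom_ext _ _ fun i => ?_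
    change r' i = biprod.desc (biprod.inl ≫ r' i) (biprod.inr ≫ r' i)
    refine biprod.hom_ext' _ _ ?_ ?_ <;> simp

end Twist

end Complexes

section Complexes

variable {V : Type*} [Category V] [Preadditive V] {X Y A B : CochainComplex V ℤ} {f : X ⟶ Y}

/-! ### Direct summands of mapping cones -/

/-- A direct summand `A` of the mapping cone of `f : X ⟶ Y`, given by the components of the
inclusion and of the projection. -/
structure ConeSummand (f : X ⟶ Y) (A : CochainComplex V ℤ) where
  toX : ∀ i j, A.X i ⟶ X.X j
  toY : ∀ i, A.X i ⟶ Y.X i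
  ofX : ∀ i j, X.X j ⟶ A.X i
  ofY : Y ⟶ A
  toX_d : ∀ i j k, i + 1 = j → j + 1 = k → toX i j ≫ X.d j k = -(A.d i j ≫ toX j k)
  d_toY : ∀ i j, i + 1 = j → A.d i j ≫ toY j = toY i ≫ Y.d i j + toX i j ≫ f.f j
  ofX_d : ∀ i j k, i + 1 = j → j + 1 = k →
    ofX i j ≫ A.d i j = f.f j ≫ ofY.f j - X.d j k ≫ ofX j k
  retract : ∀ i j, i + 1 = j → toX i j ≫ ofX i j + toY i ≫ ofY.f i = 𝟙 _

/-! ### Components of a direct summand of the cone -/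

section Cone

open CochainComplex

variable [HasBinaryBiproducts V]

/-- A direct summand of the mapping cone in terms of its components. -/
noncomputable def coneSummand (a : A ⟶ mappingCone f) (a' : mappingCone f ⟶ A)
    (h : a ≫ a' = 𝟙 A) : ConeSummand f A where
  -- The value 0 in non-adjacent degrees is a filler: all axioms concern i + 1 = j only.
  toX i j := if h : i + 1 = j then a.f i ≫ (mappingCone.fst f).1.v i j h else 0
  toY i := a.f i ≫ (mappingCone.snd f).v i i (add_zero i)
  ofX i j := if h : i + 1 = j then (mappingCone.inl f).v j i (by omega) ≫ a'.f i else 0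
  ofY := mappingCone.inr f ≫ a'
  toX_d i j k hij hjk := by
    rw [dif_pos hij, dif_pos hjk, ← a.comm_assoc, mappingCone.d_fst_v _ i j k hij hjk]
    simp
  d_toY i j hij := by
    rw [dif_pos hij, ← a.comm_assoc, mappingCone.d_snd_v _ i j hij]
    simp [add_comm]
  ofX_d i j k hij hjk := by
    rw [dif_pos hij, dif_pos hjk, Category.assoc, a'.comm,
      mappingCone.inl_v_d_assoc _ j i k (by omega) (by omega)]
    simp
  retract i j hij := by
    rw [dif_pos hij, dif_pos hij]
    have h1 := mappingCone.id_X f i j hij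
    calc _ = a.f i ≫ ((mappingCone.fst f).1.v i j hij ≫ (mappingCone.inl f).v j i (by omega) +
          (mappingCone.snd f).v i i (add_zero i) ≫ (mappingCone.inr f).f i) ≫ a'.f i := by simp
      _ = 𝟙 _ := by
        rw [h1, Category.id_comp, ← HomologicalComplex.comp_f, h, HomologicalComplex.id_f]

/-- The three relations are the vanishing of A → B and the diagonal entries, on X[1] and on Y, of
the identity of the cone. -/
theorem exists_coneSummands (D : Decomposition (mappingCone f) A B) :
    ∃ (S : ConeSummand f A) (T : ConeSummand f B),
      (∀ i j, i + 1 = j → S.toX i j ≫ T.ofX i j + S.toY i ≫ T.ofY.f i = 0) ∧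
      (∀ i j, i + 1 = j → S.ofX i j ≫ S.toX i j + T.ofX i j ≫ T.toX i j = 𝟙 _) ∧
      (∀ i, S.ofY.f i ≫ S.toY i + T.ofY.f i ≫ T.toY i = 𝟙 _) := by
  have htot (i : ℤ) : D.prA.f i ≫ D.inA.f i + D.prB.f i ≫ D.inB.f i = 𝟙 _ := by
    rw [← HomologicalComplex.comp_f, ← HomologicalComplex.comp_f, ← HomologicalComplex.add_f_apply,
      D.total, HomologicalComplex.id_f]
  refine ⟨coneSummand D.inA D.prA D.inA_prA, coneSummand D.inB D.prB D.inB_prB,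
    fun i j hij => ?_, fun i j hij => ?_, fun i => ?_⟩
  · simp only [coneSummand, dif_pos hij]
    calc _ = D.inA.f i ≫ ((mappingCone.fst f).1.v i j hij ≫ (mappingCone.inl f).v j i (by omega) +
          (mappingCone.snd f).v i i (add_zero i) ≫ (mappingCone.inr f).f i) ≫ D.prB.f i := by simp
      _ = 0 := by
        rw [mappingCone.id_X f i j hij, Category.id_comp, ← HomologicalComplex.comp_f, D.inA_prB,
          HomologicalComplex.zero_f]
  · simp only [coneSummand, dif_pos hij]
    calc _ = (mappingCone.inl f).v j i (by omega) ≫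
          (D.prA.f i ≫ D.inA.f i + D.prB.f i ≫ D.inB.f i) ≫ (mappingCone.fst f).1.v i j hij := by
          simp
      _ = 𝟙 _ := by rw [htot, Category.id_comp, mappingCone.inl_v_fst_v]
  · simp only [coneSummand]
    calc _ = (mappingCone.inr f).f i ≫
          (D.prA.f i ≫ D.inA.f i + D.prB.f i ≫ D.inB.f i) ≫
            (mappingCone.snd f).v i i (add_zero i) := by simp
      _ = 𝟙 _ := by rw [htot, Category.id_comp, mappingCone.inr_f_snd_v]

end Cone

/-! ### Null-homotopies from split factors -/

/-- If the component to `X` of a summand `A` of the cone of `f` is null-homotopic, then `f` is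
null-homotopic or `A` is contractible. -/
theorem isNullHomotopic_of_section (S : ConeSummand f A)
    (hY : ∀ φ : Y ⟶ Y, IsIso φ ∨ IsNilpotent (show End Y from φ)) (ρ : ∀ i, A.X i ⟶ X.X i)
    (hρ : ∀ i j, i + 1 = j → S.toX i j = A.d i j ≫ ρ j - ρ i ≫ X.d i j) :
    IsNullHomotopic f ∨ IsNullHomotopic (𝟙 A) := by
  -- `toY` commutes with the differentials only up to `toX ≫ f`; the correction by ρ removes this
  -- defect.
  let t : A ⟶ Y :=
    { f := fun i => S.toY i - ρ i ≫ f.f i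
      comm' := fun i j hij => by
        rw [Preadditive.comp_sub, S.d_toY i j hij, hρ i j hij]
        simp only [Preadditive.sub_comp, Category.assoc, f.comm]
        abel }
  rcases hY (S.ofY ≫ t) with h | h
  · left
    let v : A ⟶ Y := t ≫ inv (S.ofY ≫ t)
    have hv : S.ofY ≫ v = 𝟙 Y := by
      rw [← Category.assoc, IsIso.hom_inv_id]
    -- The composite X → Y → A is null-homotopic through `ofX`, and v retracts A onto Y.
    refine ⟨fun i j => S.ofX i j ≫ v.f i, fun i j k hij hjk => ?_⟩
    have hvj : S.ofY.f j ≫ v.f j = 𝟙 _ := by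
      rw [← HomologicalComplex.comp_f, hv, HomologicalComplex.id_f]
    rw [Category.assoc, v.comm, ← Category.assoc (S.ofX i j), S.ofX_d i j k hij hjk,
      Preadditive.sub_comp, Category.assoc, hvj, Category.comp_id, Category.assoc]
    abel
  · right
    refine isNullHomotopic_id_of_isNilpotent (v := t ≫ S.ofY) ?_ (isNilpotent_comp _ _ h)
    refine ⟨fun i j => ρ j ≫ S.ofX i j, fun i j k hij hjk => ?_⟩
    change 𝟙 _ - (S.toY j - ρ j ≫ f.f j) ≫ S.ofY.f j = _
    rw [← S.retract j k hjk, Category.assoc, S.ofX_d i j k hij hjk, hρ j k hjk]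
    simp only [Preadditive.sub_comp, Preadditive.comp_sub, Category.assoc]
    abel

/-- If the component from `Y` of a summand `B` of the cone of `f` is null-homotopic by a homotopy
that factors through `X`, then `f` is null-homotopic or `B` is contractible. -/
theorem isNullHomotopic_of_retraction (S : ConeSummand f A) (T : ConeSummand f B)
    (hST : ∀ i j, i + 1 = j → S.toX i j ≫ T.ofX i j + S.toY i ≫ T.ofY.f i = 0)
    (hX : ∀ φ : X ⟶ X, IsIso φ ∨ IsNilpotent (show End X from φ)) (κ : Y ⟶ A)
    (l : ∀ i, Y.X i ⟶ X.X i) (hκ : ∀ i, κ.f i ≫ S.toY i + l i ≫ f.f i = 𝟙 _)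
    (hl : ∀ i j, i + 1 = j → l i ≫ X.d i j - κ.f i ≫ S.toX i j = Y.d i j ≫ l j) :
    IsNullHomotopic f ∨ IsNullHomotopic (𝟙 B) := by
  have hκT (i j : ℤ) (hij : i + 1 = j) : κ.f i ≫ S.toX i j ≫ T.ofX i j =
      l i ≫ f.f i ≫ T.ofY.f i - T.ofY.f i := by
    rw [eq_neg_of_add_eq_zero_left (hST i j hij), Preadditive.comp_neg, ← Category.assoc,
      eq_sub_of_add_eq (hκ i)]
    simp
  have hlT (i j : ℤ) (hij : i + 1 = j) : Y.d i j ≫ l j ≫ T.ofX i j =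
      l i ≫ X.d i j ≫ T.ofX i j - l i ≫ f.f i ≫ T.ofY.f i + T.ofY.f i := by
    rw [← Category.assoc, ← hl i j hij, Preadditive.sub_comp, Category.assoc, Category.assoc,
      hκT i j hij]
    abel
  -- Correcting `ofX` by l yields a chain map X[1] → B; the composites with `toX` are the maps u and
  -- v below.
  let t (i j : ℤ) : X.X j ⟶ B.X i := T.ofX i j - f.f j ≫ l j ≫ T.ofX i j
  have ht (i j k : ℤ) (hij : i + 1 = j) (hjk : j + 1 = k) :
      t i j ≫ B.d i j = -(X.d j k ≫ t j k) := by
    simp only [t, Preadditive.sub_comp, Preadditive.comp_sub, Category.assoc,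
      T.ofX_d i j k hij hjk]
    rw [← f.comm_assoc, hlT j k hjk]
    simp only [Preadditive.comp_add, Preadditive.comp_sub]
    abel
  obtain ⟨u, v, hu, hv, huv⟩ := exists_endomorphisms T.toX t T.toX_d ht
  rcases hX u with h | h
  · left
    obtain ⟨w, hw⟩ : ∃ w, w ≫ u = 𝟙 X := ⟨inv u, IsIso.inv_hom_id u⟩
    -- The composite B → X[1] → Y[1] is null-homotopic through `toY`, and w followed by t is a
    -- section of B → X[1].
    refine ⟨fun i j => -(w.f j ≫ t i j ≫ T.toY i), fun i j k hij hjk => ?_⟩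
    have h1 : w.f j ≫ t i j ≫ T.toX i j = 𝟙 _ := by
      rw [← hu i j hij, ← HomologicalComplex.comp_f, hw, HomologicalComplex.id_f]
    have h2 : T.toY i ≫ Y.d i j = B.d i j ≫ T.toY j - T.toX i j ≫ f.f j :=
      eq_sub_of_add_eq (T.d_toY i j hij).symm
    have h3 : w.f j ≫ t i j ≫ T.toX i j ≫ f.f j = f.f j := by
      have := congrArg (· ≫ f.f j) h1
      simpa using this
    simp only [Preadditive.neg_comp, Preadditive.comp_neg, Category.assoc, h2, Preadditive.comp_sub,
      h3]
    rw [← Category.assoc (t i j), ht i j k hij hjk]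
    simp
  · right
    refine isNullHomotopic_id_of_isNilpotent (v := v) ?_ (huv h)
    refine ⟨fun i j => T.toY j ≫ l j ≫ T.ofX i j, fun i j k hij hjk => ?_⟩
    rw [HomologicalComplex.sub_f_apply, HomologicalComplex.id_f, hv j k hjk, ← T.retract j k hjk]
    have h1 : T.toX j k ≫ f.f k = B.d j k ≫ T.toY k - T.toY j ≫ Y.d j k := by
      rw [T.d_toY j k hjk]
      abel
    have h2 : l j ≫ T.ofX i j ≫ B.d i j =
        l j ≫ f.f j ≫ T.ofY.f j - l j ≫ X.d j k ≫ T.ofX j k := by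
      rw [T.ofX_d i j k hij hjk, Preadditive.comp_sub]
    simp only [t, Preadditive.comp_sub, Category.assoc, h2]
    rw [← Category.assoc (T.toX j k) (f.f k), h1]
    simp only [Preadditive.comp_sub, Preadditive.sub_comp, Category.assoc, hlT j k hjk,
      Preadditive.comp_add]
    abel

/-! ### Contractible summands carrying an extreme cell -/

theorem isNullHomotopic_zero : IsNullHomotopic (0 : X ⟶ Y) :=
  ⟨fun _ _ => 0, fun i j k _ _ => by simp⟩

/-- If a contractible summand of the cone of `f` contains the highest cell of `Y`, then `f` is
null-homotopic. -/
theorem isNullHomotopic_of_contractible_top (S : ConeSummand f A) (hY : HasTrivialIdempotents Y)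
    (hA : IsNullHomotopic (𝟙 A)) {i j : ℤ} (hij : i + 1 = j) (hXj : IsZero (X.X j))
    (hYj : ¬ IsZero (Y.X j)) (hAj : ∀ k, j < k → IsZero (A.X k))
    (hS : S.ofY.f j ≫ S.toY j = 𝟙 _) : IsNullHomotopic f := by
  obtain ⟨s, hs⟩ := hA
  have h1 := hs i j (j + 1) hij rfl
  rw [(hAj (j + 1) (by omega)).eq_of_tgt (A.d j (j + 1)) 0, zero_comp, zero_add,
    HomologicalComplex.id_f] at h1
  -- The contraction of A makes the last differential of Y a split epimorphism, so Y consists of one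
  -- isomorphism in degrees i, j.
  have h2 : (S.ofY.f j ≫ s i j ≫ S.toY i) ≫ Y.d i j = 𝟙 _ := by
    rw [← hS]
    rw [← Category.id_comp (S.toY j), h1, Category.assoc, Category.assoc, Category.assoc, S.d_toY i j hij,
      hXj.eq_of_tgt (S.toX i j) 0, zero_comp, add_zero]
  obtain ⟨h3, -, h4⟩ := isZero_of_split_d hY hij (S.ofY.f j ≫ s i j ≫ S.toY i)
    (by rw [h2, Category.comp_id]) (fun h => hYj (by
      rw [IsZero.iff_id_eq_zero, ← h2, h, comp_zero]))
  have h5 : f = 0 := by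
    ext k
    by_cases hkj : k = j
    · subst hkj
      exact hXj.eq_of_src _ _
    · by_cases hki : k = i
      · subst hki
        rw [← Category.comp_id (f.f k), ← h3, ← Category.assoc, f.comm, hXj.eq_of_src (f.f j) 0]
        simp
      · exact (h4 k hki hkj).eq_of_tgt _ _
  rw [h5]
  exact isNullHomotopic_zero

/-- If a contractible summand of the cone of `f` contains the lowest cell of `X`, then `f` is
null-homotopic. -/
theorem isNullHomotopic_of_contractible_bot (T : ConeSummand f B) (hX : HasTrivialIdempotents X)
    (hB : IsNullHomotopic (𝟙 B)) {i j : ℤ} (hij : i + 1 = j) (hYj : IsZero (Y.X j))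
    (hXj : ¬ IsZero (X.X j)) (hBi : ∀ k, k < i → IsZero (B.X k))
    (hT : T.ofX i j ≫ T.toX i j = 𝟙 _) : IsNullHomotopic f := by
  obtain ⟨k, hjk⟩ : ∃ k, j + 1 = k := ⟨_, rfl⟩
  obtain ⟨s, hs⟩ := hB
  have h1 := hs (i - 1) i j (by omega) hij
  rw [(hBi (i - 1) (by omega)).eq_of_src (B.d (i - 1) i) 0, comp_zero, add_zero,
    HomologicalComplex.id_f] at h1
  -- Dually, the first differential of X is a split monomorphism.
  have h2 : X.d j k ≫ (-(T.ofX j k ≫ s i j ≫ T.toX i j)) = 𝟙 _ := by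
    rw [← hT]
    nth_rw 2 [← Category.id_comp (T.toX i j)]
    rw [h1, Category.assoc, ← Category.assoc (T.ofX i j), T.ofX_d i j k hij hjk,
      hYj.eq_of_tgt (f.f j) 0]
    simp
  obtain ⟨-, h3, h4⟩ := isZero_of_split_d hX hjk (-(T.ofX j k ≫ s i j ≫ T.toX i j))
    (by rw [← Category.assoc, h2, Category.id_comp]) (fun h => hXj (by
      rw [IsZero.iff_id_eq_zero, ← h2, h, zero_comp]))
  have h5 : f = 0 := by
    ext l
    by_cases hlj : l = j
    · subst hlj
      exact hYj.eq_of_tgt _ _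
    · by_cases hlk : l = k
      · subst hlk
        rw [← Category.id_comp (f.f l), ← h3, Category.assoc, ← f.comm, hYj.eq_of_tgt (f.f j) 0]
        simp
      · exact (h4 l hlj hlk).eq_of_src _ _
  rw [h5]
  exact isNullHomotopic_zero

end Complexes

section Algebra

variable {Λ : Type w} [Ring Λ] {n : ℕ} {X Y : FixedSizeComplex Λ n} {f : X ⟶ Y}

/-! ### Factorizations of irreducible morphisms -/

theorem IsIrreducibleMorphism.exists_of_factorization (hf : IsIrreducibleMorphism f)
    {W : ProjComplex Λ} (hW : isFixedSize Λ n W) (g : X.obj ⟶ W) (h : W ⟶ Y.obj)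
    (hgh : g ≫ h = f.hom) :
    (∃ r : W ⟶ X.obj, g ≫ r = 𝟙 _) ∨ (∃ k : Y.obj ⟶ W, k ≫ h = 𝟙 _) := by
  let W' : FixedSizeComplex Λ n := ⟨W, hW⟩
  obtain ⟨⟨⟨s⟩⟩⟩ | ⟨⟨⟨s⟩⟩⟩ := hf.2.2 (ObjectProperty.homMk g : X ⟶ W') (ObjectProperty.homMk h : W' ⟶ Y)
    (by ext1; exact hgh)
  · exact Or.inl ⟨s.retraction.hom, congrArg (fun φ : X ⟶ X => φ.hom) s.id⟩
  · exact Or.inr ⟨s.section_.hom, congrArg (fun φ : Y ⟶ Y => φ.hom) s.id⟩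

/-- The cells of a graded object in the degrees with a given property. -/
theorem exists_restriction (Z : ℤ → ProjMod Λ) (p : ℤ → Prop) :
    ∃ (P : ℤ → ProjMod Λ) (π : ∀ i, Z i ⟶ P i) (ι : ∀ i, P i ⟶ Z i),
      (∀ i, ¬ p i → IsZero (P i)) ∧ (∀ i, p i → π i ≫ ι i = 𝟙 _) ∧ (∀ i, ι i ≫ π i = 𝟙 _) := by
  have h (i : ℤ) : ∃ (P : ProjMod Λ) (π : Z i ⟶ P) (ι : P ⟶ Z i),
      (¬ p i → IsZero P) ∧ (p i → π ≫ ι = 𝟙 _) ∧ ι ≫ π = 𝟙 _ := by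
    by_cases hi : p i
    · exact ⟨Z i, 𝟙 _, 𝟙 _, fun h => absurd hi h, fun _ => by simp, by simp⟩
    · obtain ⟨O, hO⟩ := HasZeroObject.zero (C := ProjMod Λ)
      exact ⟨O, 0, 0, fun _ => hO, fun h => absurd h hi, hO.eq_of_src _ _⟩
  choose P π ι h1 h2 h3 using h
  exact ⟨P, π, ι, h1, h2, h3⟩

theorem isZero_of_comp_eq_id {Z W : ProjComplex Λ} {g : Z ⟶ W} {r : W ⟶ Z} (h : g ≫ r = 𝟙 _)
    {i : ℤ} (hW : IsZero (W.X i)) : IsZero (Z.X i) :=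
  isZero_of_retract (g.f i) (r.f i)
    (by rw [← HomologicalComplex.comp_f, h, HomologicalComplex.id_f]) hW

/-- An irreducible morphism `f : X ⟶ Y` cannot satisfy `X¹ = 0 = Yⁿ` and `Y¹ ≠ 0 ≠ Xⁿ`. -/
theorem IsIrreducibleMorphism.false_of_isZero (hf : IsIrreducibleMorphism f)
    (hX1 : IsZero (X.obj.X 1)) (hY1 : ¬ IsZero (Y.obj.X 1)) (hXn : ¬ IsZero (X.obj.X n))
    (hYn : IsZero (Y.obj.X n)) : False := by
  -- Deleting Y¹ leaves a subcomplex, since Y⁰ = 0; it contains the image of f because X¹ = 0.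
  obtain ⟨P, π, ι, hP, hπι, hιπ⟩ := exists_restriction Y.obj.X (· ≠ 1)
  have hd (i j k : ℤ) (hij : i + 1 = j) : Y.obj.d i j ≫ π j ≫ ι j = Y.obj.d i j := by
    by_cases hj : j = 1
    · exact (Y.property i (Or.inl (by omega))).eq_of_src _ _
    · rw [hπι j hj, Category.comp_id]
  have hfπ (i : ℤ) : f.hom.f i ≫ π i ≫ ι i = f.hom.f i := by
    by_cases hi : i = 1
    · subst hi
      exact hX1.eq_of_src _ _
    · rw [hπι i hi, Category.comp_id]
  let W : ProjComplex Λ :=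
    { X := P
      d := fun i j => ι i ≫ Y.obj.d i j ≫ π j
      shape := fun i j hij => by rw [Y.obj.shape i j hij]; simp
      d_comp_d' := fun i j k hij _ => by
        have := hd i j k hij
        simp only [Category.assoc]
        rw [reassoc_of% this]
        simp }
  let g : X.obj ⟶ W :=
    { f := fun i => f.hom.f i ≫ π i
      comm' := fun i j _ => by
        change (f.hom.f i ≫ π i) ≫ ι i ≫ Y.obj.d i j ≫ π j = _
        rw [Category.assoc, reassoc_of% (hfπ i), ← Category.assoc, f.hom.comm, Category.assoc] }
  let h : W ⟶ Y.obj :=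
    { f := ι
      comm' := fun i j hij => by
        change ι i ≫ _ = (ι i ≫ Y.obj.d i j ≫ π j) ≫ ι j
        simp only [Category.assoc]
        rw [hd i j (j + 1) hij] }
  have hW (i : ℤ) (hi : IsZero (Y.obj.X i)) : IsZero (W.X i) :=
    isZero_of_retract (ι i) (π i) (hιπ i) hi
  rcases hf.exists_of_factorization (W := W) (fun i hi => hW i (Y.property i hi)) g h
    (by ext1 i; exact (Category.assoc _ _ _).trans (hfπ i)) with ⟨r, hr⟩ | ⟨k, hk⟩
  · exact hXn (isZero_of_comp_eq_id hr (hW _ hYn))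
  · exact hY1 (isZero_of_comp_eq_id hk (hP 1 (by simp)))

/-- An irreducible morphism `f : X ⟶ Y` with `Xⁿ = 0` and `Y¹ = 0` is not null-homotopic, unless
`X¹ = 0` or `Yⁿ = 0`. -/
theorem IsIrreducibleMorphism.not_isNullHomotopic (hf : IsIrreducibleMorphism f)
    (hX1 : ¬ IsZero (X.obj.X 1)) (hY1 : IsZero (Y.obj.X 1)) (hXn : IsZero (X.obj.X n))
    (hYn : ¬ IsZero (Y.obj.X n)) : ¬ IsNullHomotopic f.hom := by
  rintro ⟨s, hs⟩
  -- The homotopy only sees these cells of X: from degree 2 it lands in Y¹ = 0, and Xⁿ = 0.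
  obtain ⟨P, π, ι, hP, hπι, hιπ⟩ := exists_restriction X.obj.X (fun i => 2 < i ∧ i < n)
  have hπs (i j : ℤ) (hij : i + 1 = j) : π j ≫ ι j ≫ s i j = s i j := by
    by_cases hj : 2 < j ∧ j < n
    · rw [← Category.assoc, hπι j hj, Category.id_comp]
    · by_cases h1 : i < 1
      · exact (Y.property i (Or.inl h1)).eq_of_tgt _ _
      · by_cases h2 : i = 1
        · subst h2
          exact hY1.eq_of_tgt _ _
        · by_cases h3 : j = n
          · subst h3
            exact hXn.eq_of_src _ _
          · exact (X.property j (Or.inr (by omega))).eq_of_src _ _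
  let P₀ : ProjComplex Λ := { X := P, d := 0 }
  let P₁ : ProjComplex Λ := { X := fun i => P (i + 1), d := 0 }
  -- Twisting by the identity gives the contractible complex with cells P (i + 1) ⊕ P i, confined to
  -- degrees 2, …, n - 1.
  let θ (i j : ℤ) : P₁.X i ⟶ P₀.X j := if h : i + 1 = j then eqToHom (congrArg P h) else 0
  have hθ (i j k : ℤ) (hij : i + 1 = j) (hjk : j + 1 = k) :
      θ i j ≫ P₀.d j k = -(P₁.d i j ≫ θ j k) := by
    simp [P₀, P₁]
  have hθ' (i : ℤ) : θ i (i + 1) = 𝟙 (P (i + 1)) := dif_pos rfl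
  let α : X.obj ⟶ P₁ :=
    { f := fun i => X.obj.d i (i + 1) ≫ π (i + 1)
      comm' := fun i j hij => by
        obtain rfl : i + 1 = j := hij
        simp [P₁] }
  let g : X.obj ⟶ twist θ hθ := twistLift hθ α π fun i j hij => by
    subst hij
    rw [hθ']
    change π i ≫ 0 + (X.obj.d i (i + 1) ≫ π (i + 1)) ≫ 𝟙 _ = _
    simp
  let β : P₀ ⟶ Y.obj :=
    { f := fun i => ι i ≫ s (i - 1) i ≫ Y.obj.d (i - 1) i
      comm' := fun i j _ => by simp [P₀] }
  let h : twist θ hθ ⟶ Y.obj := twistDesc hθ (fun i => ι (i + 1) ≫ s i (i + 1)) β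
    fun i j hij => by
      subst hij
      rw [hθ']
      change _ = 0 ≫ _ + 𝟙 _ ≫ ι (i + 1) ≫ s (i + 1 - 1) (i + 1) ≫ Y.obj.d (i + 1 - 1) (i + 1)
      have : i + 1 - 1 = i := by omega
      rw [this]
      simp
  have hgh : g ≫ h = f.hom := by
    ext1 i
    rw [twistLift_desc_f]
    change (X.obj.d i (i + 1) ≫ π (i + 1)) ≫ ι (i + 1) ≫ s i (i + 1) +
      π i ≫ ι i ≫ s (i - 1) i ≫ Y.obj.d (i - 1) i = _
    rw [Category.assoc, hπs i (i + 1) rfl,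
      reassoc_of% (hπs (i - 1) i (by omega)), hs (i - 1) i (i + 1) (by omega) rfl]
  have hW (i : ℤ) (hi : i ≤ 1 ∨ n ≤ i) : IsZero ((twist θ hθ).X i) :=
    isZero_twist_X hθ (hP (i + 1) (by omega)) (hP i (by omega))
  rcases hf.exists_of_factorization (fun i hi => hW i (by omega)) g h hgh with ⟨r, hr⟩ | ⟨k, hk⟩
  · exact hX1 (isZero_of_comp_eq_id hr (hW 1 (by omega)))
  · exact hYn (isZero_of_comp_eq_id hk (hW n (by omega)))

/-- If the mapping cone of an irreducible morphism `f : X ⟶ Y` with `Xⁿ = 0` and `Y¹ = 0` is the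
direct sum of a complex that vanishes in degree `0` and a complex that vanishes in degree `n`, then
`f` is null-homotopic, unless `X¹ = 0` or `Yⁿ = 0`. -/
theorem IsIrreducibleMorphism.isNullHomotopic [IsArtinianRing Λᵐᵒᵖ] (hf : IsIrreducibleMorphism f)
    (hX : HasTrivialIdempotents X.obj) (hY : HasTrivialIdempotents Y.obj)
    (hX1 : ¬ IsZero (X.obj.X 1)) (hY1 : IsZero (Y.obj.X 1)) (hXn : IsZero (X.obj.X n))
    (hYn : ¬ IsZero (Y.obj.X n)) {A B : ProjComplex Λ}
    (hA : IsZero (A.X 0)) (hB : IsZero (B.X n))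
    (D : Decomposition (CochainComplex.mappingCone f.hom) A B) : IsNullHomotopic f.hom := by
  have hcone (i : ℤ) (hi : i < 0 ∨ n < i) : IsZero ((CochainComplex.mappingCone f.hom).X i) :=
    (CochainComplex.mappingCone.isZero_X_iff f.hom i).2
      ⟨X.property (i + 1) (by omega), Y.property i (by omega)⟩
  have hA' (i : ℤ) (hi : i < 0 ∨ n < i) : IsZero (A.X i) :=
    isZero_of_comp_eq_id D.inA_prA (hcone i hi)
  have hB' (i : ℤ) (hi : i < 0 ∨ n < i) : IsZero (B.X i) :=
    isZero_of_comp_eq_id D.inB_prB (hcone i hi)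
  obtain ⟨S, T, hST, htotX, htotY⟩ := exists_coneSummands D
  -- The twisted sum is the cocone of A → X[1]; the sign makes `S.toY` and f combine into a chain
  -- map to Y.
  let θ (i j : ℤ) : A.X i ⟶ X.obj.X j := -S.toX i j
  have hθ (i j k : ℤ) (hij : i + 1 = j) (hjk : j + 1 = k) :
      θ i j ≫ X.obj.d j k = -(A.d i j ≫ θ j k) := by
    simp [θ, S.toX_d i j k hij hjk]
  let g : X.obj ⟶ twist θ hθ := twistLift hθ 0 (fun i => 𝟙 _) fun i j _ => by simp
  let h : twist θ hθ ⟶ Y.obj := twistDesc hθ S.toY f.hom fun i j hij => by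
    rw [S.d_toY i j hij]
    simp [θ]
  have hgh : g ≫ h = f.hom := by
    ext1 i
    rw [twistLift_desc_f]
    simp
  have hW : isFixedSize Λ n (twist θ hθ) := by
    intro i hi
    refine isZero_twist_X hθ ?_ (X.property i hi)
    -- Degree 0 is the only degree of the cone outside 1, …, n; the choice of A removes it.
    by_cases h0 : i = 0
    · subst h0
      exact hA
    · exact hA' i (by omega)
  have hn : ((n : ℤ) - 1) + 1 = n := by omega
  rcases hf.exists_of_factorization hW g h hgh with ⟨r, hr⟩ | ⟨k, hk⟩
  · obtain ⟨ρ, φ, hρ, rfl⟩ := exists_eq_twistDesc hθ r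
    have hφ (i : ℤ) : φ.f i = 𝟙 _ := by
      have h1 : (g ≫ twistDesc hθ ρ φ hρ).f i = 𝟙 _ := congrArg (fun ψ : X.obj ⟶ X.obj => ψ.f i) hr
      rw [twistLift_desc_f] at h1
      simpa using h1
    have hS (i j : ℤ) (hij : i + 1 = j) : S.toX i j = A.d i j ≫ ρ j - ρ i ≫ X.obj.d i j := by
      rw [hρ i j hij, hφ]
      simp [θ]
    refine (isNullHomotopic_of_section S (isIso_or_isNilpotent Y.property hY) ρ hS).elim id
      fun h1 => isNullHomotopic_of_contractible_top S hY h1 hn hXn hYn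
        (fun k hk => hA' k (by omega)) ?_
    -- Since Bⁿ = 0, the whole cell Yⁿ lies in A.
    have := htotY n
    rwa [hB.eq_of_src (T.toY n) 0, comp_zero, add_zero] at this
  · obtain ⟨κ, l, hl, rfl⟩ := exists_eq_twistLift hθ k
    have hκ (i : ℤ) : κ.f i ≫ S.toY i + l i ≫ f.hom.f i = 𝟙 _ := by
      have h1 : (twistLift hθ κ l hl ≫ h).f i = 𝟙 _ :=
        congrArg (fun ψ : Y.obj ⟶ Y.obj => ψ.f i) hk
      rwa [twistLift_desc_f] at h1
    have hl' (i j : ℤ) (hij : i + 1 = j) :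
        l i ≫ X.obj.d i j - κ.f i ≫ S.toX i j = Y.obj.d i j ≫ l j := by
      rw [← hl i j hij]
      simp [θ, sub_eq_add_neg]
    refine (isNullHomotopic_of_retraction S T hST (isIso_or_isNilpotent X.property hX) κ l hκ
      hl').elim id fun h1 => isNullHomotopic_of_contractible_bot T hX h1 (zero_add 1) hY1 hX1
        (fun k hk => hB' k (by omega)) ?_
    -- Since A⁰ = 0, the whole cell X¹, in degree 0 of the cone, lies in B.
    have := htotX 0 1 (zero_add 1)
    rwa [hA.eq_of_src (S.toX 0 1) 0, comp_zero, zero_add] at this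

end Algebra

/-! ### Passage to all complexes and the main theorem -/

theorem hasTrivialIdempotents_obj {Λ : Type w} [Ring Λ] {n : ℕ} {X : FixedSizeComplex Λ n}
    (hX : HasTrivialIdempotents X) : HasTrivialIdempotents X.obj := fun e he =>
  (hX (ObjectProperty.homMk e) (by ext1; exact he)).imp
    (congrArg fun φ : X ⟶ X => φ.hom) (congrArg fun φ : X ⟶ X => φ.hom)

end FixedSizeComplexes

/-- Let `Λ` be a finite-dimensional algebra over an algebraically closed field whose strong global
dimension is finite, equal to `η ≥ 1`. If `f : X ⟶ Y` is an irreducible morphism between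
indecomposable objects of `C_{η+2}(proj Λ)`, then `X¹ = 0 = Y¹` or `X^{η+2} = 0 = Y^{η+2}`. -/
theorem proposition2p4 (K : Type u) [Field K] [IsAlgClosed K]
    (Λ : Type w) [Ring Λ] [Algebra K Λ] [FiniteDimensional K Λ]
    (η : ℕ) (hη : 1 ≤ η)
    (hΛ : FixedSizeComplexes.strongGlobalDimension Λ = (η : ℕ∞))
    (X Y : FixedSizeComplexes.FixedSizeComplex Λ (η + 2))
    (hX : Indecomposable X) (hY : Indecomposable Y)
    (f : X ⟶ Y) (hf : FixedSizeComplexes.IsIrreducibleMorphism f) :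
    (IsZero (X.obj.X 1) ∧ IsZero (Y.obj.X 1)) ∨
      (IsZero (X.obj.X ((η : ℤ) + 2)) ∧ IsZero (Y.obj.X ((η : ℤ) + 2))) := by
  open FixedSizeComplexes in
  have : IsArtinianRing Λᵐᵒᵖ := IsArtinianRing.of_finite K Λᵐᵒᵖ
  have hX' := hasTrivialIdempotents_obj (hasTrivialIdempotents_of_indecomposable hX)
  have hY' := hasTrivialIdempotents_obj (hasTrivialIdempotents_of_indecomposable hY)
  have hn : ((η + 2 : ℕ) : ℤ) = η + 2 := by push_cast; rfl
  -- The interval from 1 to η + 2 has length η + 1 > η; since η ≥ 1, it is also too long for a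
  -- two-term contractible complex.
  have hXz := isZero_of_strongGlobalDimension_le hΛ.le X.property hX' (by omega) (by omega)
  have hYz := isZero_of_strongGlobalDimension_le hΛ.le Y.property hY' (by omega) (by omega)
  rw [← hn]
  by_contra! h
  by_cases hX1 : IsZero (X.obj.X 1)
  · have hY1 := h.1 hX1
    have hYn := hYz.resolve_left hY1
    exact hf.false_of_isZero hX1 hY1 (fun h' => h.2 h' hYn) hYn
  · have hXn := hXz.resolve_left hX1
    have hYn := h.2 hXn
    have hY1 := hYz.resolve_right hYn
    have hC (i : ℤ) (hi : i < 0 ∨ ((η + 2 : ℕ) : ℤ) < i) :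
        IsZero ((CochainComplex.mappingCone f.hom).X i) :=
      (CochainComplex.mappingCone.isZero_X_iff f.hom i).2
        ⟨X.property (i + 1) (by omega), Y.property i (by omega)⟩
    obtain ⟨A, B, hA, hB, ⟨D⟩⟩ :=
      exists_decomposition hΛ.le (by omega) (by omega) _ _ (Nat.lt_succ_self _) hC
    exact hf.not_isNullHomotopic hX1 hY1 hXn hYn
      (hf.isNullHomotopic hX' hY' hX1 hY1 hXn hYn hA hB D)
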